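/- Consider the linear system $\dot x = Ax + Bu + B_v v$ with $x(t)\in\mathbb R^n$, control input $u$ and bounded unknown input $v$, and $N$ observer nodes. For each node $i$, suppose $Bu+B_vv=B_iu_i+B_{-i}u_{-i}$, where node $i$ knows the input $u_i$ and the output $y_i=C_ix\in\mathbb R^{p_i}$, where $u_{-i}$ is bounded and unavailable to node $i$, and where $C_i$ has full row rank and $B_{-i}$ has full column rank. The nodes communicate over a connected undirected graph with nonnegative weights $a_{ij}=a_{ji}$, $a_{ii}=0$. For $\delta\ge 0$ let $\Omega_i(\delta)$ be the set of quadruples $(T,E,F,G)\in\mathbb R^{n\times\delta}\times\mathbb R^{\delta\times\delta}\times\mathbb R^{\delta\times p_i}\times\mathbb R^{\delta\times p_i}$ with $$T^\top T=I,\quad GC_iB_{-i}=T^\top B_{-i},\quad ET^\top+(GC_i-T^\top)A+(F-EG)C_i=0,$$ and such that either all eigenvalues of $E$ have negative real part, or $\delta=p_i$ and $E=0$. Let $\delta_i$ be the largest $\delta$ with $\Omega_i(\delta)\neq\emptyset$ and let $(T_{id},E_i,F_i,G_i)\in\Omega_i(\delta_i)$, where, if $E_i=0$, the quadruple is chosen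 with $G_iC_i=T_{id}^\top$ and $F_i=0$. Assume collective strong detectability: $\sum_{i=1}^N\operatorname{Im}T_{id}=\mathbb R^n$. Let $T_{iu}\in\mathbb R^{n\times(n-\delta_i)}$ satisfy $T_{id}^\top T_{iu}=0$, $T_{iu}^\top T_{iu}=I$, $T_{iu}T_{iu}^\top=I-T_{id}T_{id}^\top$. Put $\bar E_i=T_{id}E_iT_{id}^\top+T_{iu}T_{iu}^\top A$, $\bar G_i=T_{id}G_i$, $\bar F_i=T_{id}F_i+T_{iu}T_{iu}^\top A\bar G_i$, $\bar B_i=(I-\bar G_iC_i)B_i$, and let $h(\omega)=\omega/\|\omega\|$ for $\omega\ne0$, $h(0)=0$. Consider the distributed observer $$\dot z_i=\bar E_iz_i+\bar F_iy_i+\bar B_iu_i-\gamma_iT_{iu}\varepsilon_{iu}-\gamma_{is}T_{iu}h(\varepsilon_{iu}),\quad \hat x_i=z_i+\bar G_iy_i,\quad \varepsilon_{iu}=T_{iu}^\top\sum_{j=1}^N a_{ij}(\hat x_i-\hat x_j),$$ $$\dot\gamma_i=\phi_i\|\varepsilon_{iu}\|^2,\qquad \dot\gamma_{is}=\phi_{is}\|\varepsilon_{iu}\|,$$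 with $z_i(0)=0$, $\phi_i,\phi_{is}>0$, $\gamma_i(0),\gamma_{is}(0)>0$. Solutions are absolutely continuous on compact subintervals of $[0,\infty)$ and satisfy the equations for almost every $t$. The discontinuous term is understood in the sense of Filippov, i.e. at $\varepsilon_{iu}=0$ the value of $h$ may be any vector of the closed unit ball (including $0$). Then, for every initial state $x(0)$ and every solution on $[0,\infty)$, $\lim_{t\to\infty}\|\hat x_i(t)-x(t)\|=0$ for every node $i$, and the adaptive gains $\gamma_i$ and $\gamma_{is}$ remain bounded on $[0,\infty)$ for every node $i$. -/

import Mathlib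

open Filter Topology MeasureTheory

namespace DistObs

/-- Real column vectors of length `k`, with the Euclidean norm. -/
abbrev Vec (k : ℕ) := EuclideanSpace ℝ (Fin k)

/-- Matrix-vector product on Euclidean spaces. -/
noncomputable abbrev mulE {a b : ℕ} (M : Matrix (Fin a) (Fin b) ℝ) (x : Vec b) : Vec a :=
  Matrix.toEuclideanLin M x

infixr:73 " *ₑ " => mulE

/-! ### Communication graph -/

/-- An undirected weighted graph on `{1, …, N}`, given by its adjacency matrix; `(j, i)` is an edge
exactly when `weight i j` is positive. -/
structure WeightedGraph (N : ℕ) where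
  weight : Fin N → Fin N → ℝ
  nonneg : ∀ i j, 0 ≤ weight i j
  symm : ∀ i j, weight i j = weight j i
  no_loop : ∀ i, weight i i = 0

/-- Any two nodes are joined by a directed path of edges. -/
def WeightedGraph.Connected {N : ℕ} (𝒢 : WeightedGraph N) : Prop :=
  ∀ i j : Fin N, Relation.ReflTransGen (fun k l => 0 < 𝒢.weight l k) i j

/-! ### The strong detectability decomposition -/

/-- All complex eigenvalues of the real matrix `E` have negative real part. -/
def IsHurwitz {k : ℕ} (E : Matrix (Fin k) (Fin k) ℝ) : Prop :=
  ∀ μ ∈ spectrum ℂ (E.map (algebraMap ℝ ℂ)), μ.re < 0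

/-- A matrix quadruple `(T_d, E, F, G)`. -/
structure Quadruple (n p δ : ℕ) where
  Td : Matrix (Fin n) (Fin δ) ℝ
  E : Matrix (Fin δ) (Fin δ) ℝ
  F : Matrix (Fin δ) (Fin p) ℝ
  G : Matrix (Fin δ) (Fin p) ℝ

open Matrix in
/-- The set `Ω(δ)` of quadruples attached to the triplet `(A, B₋, C)`. -/
def Omega {n p r : ℕ} (A : Matrix (Fin n) (Fin n) ℝ) (Bm : Matrix (Fin n) (Fin r) ℝ)
    (C : Matrix (Fin p) (Fin n) ℝ) (δ : ℕ) : Set (Quadruple n p δ) :=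
  {q | q.Tdᵀ * q.Td = 1 ∧ q.G * C * Bm = q.Tdᵀ * Bm ∧
    q.E * q.Tdᵀ + (q.G * C - q.Tdᵀ) * A + (q.F - q.E * q.G) * C = 0 ∧
    (IsHurwitz q.E ∨ (δ = p ∧ q.E = 0))}

open Matrix in
/-- `q` is a strong detectability decomposition of `(A, B₋, C)`: an element of `Ω(δ)` for the
largest `δ` with `Ω(δ)` nonempty. In the degenerate case `E = 0` the functional `T_dᵀ x` is the one
read off statically from the measured output, `T_dᵀ = G C` with `F = 0`. -/
structure IsStrongDetectabilityDecomposition {n p r δ : ℕ} (A : Matrix (Fin n) (Fin n) ℝ)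
    (Bm : Matrix (Fin n) (Fin r) ℝ) (C : Matrix (Fin p) (Fin n) ℝ) (q : Quadruple n p δ) :
    Prop where
  mem : q ∈ Omega A Bm C δ
  maximal : ∀ ε : ℕ, 0 < ε → Omega A Bm C (δ + ε) = ∅
  static : q.E = 0 → q.G * C = q.Tdᵀ ∧ q.F = 0

open Matrix in
/-- The columns of `Tu` are an orthonormal basis of the orthogonal complement of `Im Td`. -/
structure IsComplementBasis {n δ : ℕ} (Td : Matrix (Fin n) (Fin δ) ℝ)
    (Tu : Matrix (Fin n) (Fin (n - δ)) ℝ) : Prop where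
  orthogonal : Tdᵀ * Tu = 0
  orthonormal : Tuᵀ * Tu = 1
  complement : Tu * Tuᵀ = 1 - Td * Tdᵀ

/-- The images of the matrices `T_{id}` together span `ℝⁿ`. -/
def CollectivelyStronglyDetectable {n N : ℕ} {δ : Fin N → ℕ}
    (Td : ∀ i, Matrix (Fin n) (Fin (δ i)) ℝ) : Prop :=
  ⨆ i, LinearMap.range (Matrix.toEuclideanLin (Td i)) = ⊤

/-! ### Solutions of the plant -/

/-- Absolute continuity on every compact interval `[0, T]`. -/
def LocallyAC {X : Type*} [PseudoMetricSpace X] (f : ℝ → X) : Prop :=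
  ∀ T : ℝ, 0 ≤ T → AbsolutelyContinuousOnInterval f 0 T

/-- `x` solves `ẋ = A x + B u + B_v v` on `[0, ∞)`, in the sense of Carathéodory. -/
structure IsPlantTrajectory {n m mv : ℕ} (A : Matrix (Fin n) (Fin n) ℝ)
    (B : Matrix (Fin n) (Fin m) ℝ) (Bv : Matrix (Fin n) (Fin mv) ℝ)
    (u : ℝ → Vec m) (v : ℝ → Vec mv) (x : ℝ → Vec n) : Prop where
  ac : LocallyAC x
  deriv : ∀ᵐ t : ℝ, 0 < t → HasDerivAt x (A *ₑ x t + B *ₑ u t + Bv *ₑ v t) t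

/-! ### The distributed observer -/

/-- The discontinuous function `h(ω) = ω / ‖ω‖` for `ω ≠ 0`, `h(0) = 0`. -/
noncomputable def unitDir {k : ℕ} (ω : Vec k) : Vec k := ‖ω‖⁻¹ • ω

/-- Filippov's set-valued regularization of `unitDir`: the single value `ω / ‖ω‖` where
`ω ≠ 0`, and the closed unit ball (the closed convex hull of all nearby values) at `ω = 0`. -/
def unitDirSet {k : ℕ} (ω : Vec k) : Set (Vec k) :=
  {s | (ω ≠ 0 → s = unitDir ω) ∧ ‖s‖ ≤ 1}

/-- The value of `unitDir` itself is always an admissible selection, so that ordinary solutions are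
Filippov solutions. -/
theorem unitDir_mem_unitDirSet {k : ℕ} (ω : Vec k) : unitDir ω ∈ unitDirSet ω := by
  refine ⟨fun _ => rfl, ?_⟩
  rw [unitDir, norm_smul, norm_inv, norm_norm]
  exact inv_mul_le_one

section Node

variable {n p r ml δ : ℕ}

open Matrix in
/-- `Ē = T_d E T_dᵀ + T_u T_uᵀ A`. -/
def Ebar (A : Matrix (Fin n) (Fin n) ℝ) (q : Quadruple n p δ)
    (Tu : Matrix (Fin n) (Fin (n - δ)) ℝ) : Matrix (Fin n) (Fin n) ℝ :=
  q.Td * q.E * q.Tdᵀ + Tu * Tuᵀ * A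

/-- `Ḡ = T_d G`. -/
def Gbar (q : Quadruple n p δ) : Matrix (Fin n) (Fin p) ℝ := q.Td * q.G

open Matrix in
/-- `F̄ = T_d F + T_u T_uᵀ A Ḡ`. -/
def Fbar (A : Matrix (Fin n) (Fin n) ℝ) (q : Quadruple n p δ)
    (Tu : Matrix (Fin n) (Fin (n - δ)) ℝ) : Matrix (Fin n) (Fin p) ℝ :=
  q.Td * q.F + Tu * Tuᵀ * A * Gbar q

/-- `B̄ = (I - Ḡ C) B`. -/
def Bbar (C : Matrix (Fin p) (Fin n) ℝ) (Bl : Matrix (Fin n) (Fin ml) ℝ)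
    (q : Quadruple n p δ) : Matrix (Fin n) (Fin ml) ℝ :=
  (1 - Gbar q * C) * Bl

/-- The state estimate `x̂ = z + Ḡ y` with `y = C x`. -/
noncomputable def estimate (C : Matrix (Fin p) (Fin n) ℝ) (q : Quadruple n p δ)
    (z x : Vec n) : Vec n :=
  z + Gbar q *ₑ (C *ₑ x)

end Node

open Matrix in
/-- The projected consensus error `ε_{iu} = T_{iu}ᵀ ∑ⱼ a_{ij} (x̂ᵢ - x̂ⱼ)`. -/
noncomputable def consensusError {n N k : ℕ} (𝒢 : WeightedGraph N)
    (Tu : Matrix (Fin n) (Fin k) ℝ) (xhat : Fin N → Vec n) (i : Fin N) : Vec k :=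
  Tuᵀ *ₑ (∑ j, 𝒢.weight i j • (xhat i - xhat j))

/-- `(z, γ, γs)` is a Filippov solution on `[0, ∞)` of the distributed observer with adaptive
gains, driven by the plant state `x` (through `yᵢ = Cᵢ x`) and the local inputs `uᵢ`. -/
structure IsObserverTrajectory {n N : ℕ} {p ml δ : Fin N → ℕ} (A : Matrix (Fin n) (Fin n) ℝ)
    (C : ∀ i, Matrix (Fin (p i)) (Fin n) ℝ) (Bl : ∀ i, Matrix (Fin n) (Fin (ml i)) ℝ)
    (𝒢 : WeightedGraph N) (q : ∀ i, Quadruple n (p i) (δ i))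
    (Tu : ∀ i, Matrix (Fin n) (Fin (n - δ i)) ℝ) (φ φs : Fin N → ℝ)
    (x : ℝ → Vec n) (ul : ∀ i, ℝ → Vec (ml i))
    (z : Fin N → ℝ → Vec n) (γ γs : Fin N → ℝ → ℝ) : Prop where
  ac_z : ∀ i, LocallyAC (z i)
  ac_γ : ∀ i, LocallyAC (γ i)
  ac_γs : ∀ i, LocallyAC (γs i)
  init_z : ∀ i, z i 0 = 0
  init_γ : ∀ i, 0 < γ i 0
  init_γs : ∀ i, 0 < γs i 0
  deriv_z : ∀ i, ∀ᵐ t : ℝ, 0 < t →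
    ∃ s ∈ unitDirSet
        (consensusError 𝒢 (Tu i) (fun j => estimate (C j) (q j) (z j t) (x t)) i),
      HasDerivAt (z i)
        (Ebar A (q i) (Tu i) *ₑ z i t + Fbar A (q i) (Tu i) *ₑ (C i *ₑ x t)
          + Bbar (C i) (Bl i) (q i) *ₑ ul i t
          - (γ i t • (Tu i *ₑ
                consensusError 𝒢 (Tu i) (fun j => estimate (C j) (q j) (z j t) (x t)) i)
              + γs i t • (Tu i *ₑ s))) t
  deriv_γ : ∀ i, ∀ᵐ t : ℝ, 0 < t →
    HasDerivAt (γ i)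
      (φ i *
        ‖consensusError 𝒢 (Tu i) (fun j => estimate (C j) (q j) (z j t) (x t)) i‖ ^ 2) t
  deriv_γs : ∀ i, ∀ᵐ t : ℝ, 0 < t →
    HasDerivAt (γs i)
      (φs i *
        ‖consensusError 𝒢 (Tu i) (fun j => estimate (C j) (q j) (z j t) (x t)) i‖) t

end DistObs

/-! Let `e i` be the estimation error of node i, split orthogonally along the images of `Td` and
`Tu`. The defining identities of `Omega` cancel both the unknown input and the coupling from the
detectable part, leaving `ẏ = E y`. This decays if `E` is Hurwitz. If `E = 0`, then `z(0) = 0` and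
`G C = Tdᵀ` make it vanish initially, hence forever (`tendsto_detectable_error`).

The undetectable parts are coupled through the projected Laplacian `P = Tuᵀ (L ⊗ I) Tu`. It is
symmetric, positive semidefinite and, by connectedness and collective detectability, injective
(`projectedLaplacian_injective`). The detectable errors also enter the consensus errors; adding to
the undetectable parts the preimage under `P` of that contribution gives `ζ` for which the stacked
consensus error is exactly `P ζ`. Then `ζ' = f - (γ P ζ + γs s)` with `‖f‖ ≤ K₁ ‖P ζ‖ + K₂`.

`adaptive_convergence` treats this system with the Lyapunov function `½⟪P ζ, ζ⟫` plus weighted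
squares of `γ - K₁` and `γs - K₂`. It is nonincreasing, so the gains and `P ζ` are bounded; since `γ
i` integrates `‖P ζ i‖²`, a Barbalat argument gives `P ζ → 0`. Inverting `P` recovers the
undetectable errors. -/

namespace DistObs

/-! ### Calculus of locally absolutely continuous functions -/

section Calculus

variable {X Y : Type*} [NormedAddCommGroup X] [NormedSpace ℝ X]
  [NormedAddCommGroup Y] [NormedSpace ℝ Y]

/-- `f` is locally absolutely continuous on `[0, ∞)` with derivative `f'` almost everywhere. -/
structure HasACDeriv (f f' : ℝ → X) : Prop where
  ac : LocallyAC f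
  deriv : ∀ᵐ t : ℝ, 0 < t → HasDerivAt f (f' t) t

theorem LocallyAC.comp_lipschitz {X Y : Type*} [PseudoMetricSpace X] [PseudoMetricSpace Y]
    {f : ℝ → X} (hf : LocallyAC f) {g : X → Y} {K : NNReal} (hg : LipschitzWith K g) :
    LocallyAC fun t => g (f t) := by
  intro T hT
  have h := Filter.Tendsto.const_mul (K : ℝ) (hf T hT)
  rw [mul_zero] at h
  refine squeeze_zero (fun E => Finset.sum_nonneg fun i _ => dist_nonneg) (fun E => ?_) h
  rw [Finset.mul_sum]
  exact Finset.sum_le_sum fun i _ => hg.dist_le_mul _ _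

theorem LocallyAC.mono_Icc {X : Type*} [PseudoMetricSpace X] {f : ℝ → X} (hf : LocallyAC f)
    {a b : ℝ} (ha : 0 ≤ a) (hab : a ≤ b) : AbsolutelyContinuousOnInterval f a b := by
  refine (hf b (ha.trans hab)).mono ?_
  rw [Set.uIcc_of_le hab, Set.uIcc_of_le (ha.trans hab)]
  exact Set.Icc_subset_Icc_left ha

theorem LocallyAC.continuousOn {X : Type*} [NormedAddCommGroup X] {f : ℝ → X}
    (hf : LocallyAC f) {T : ℝ} (hT : 0 ≤ T) :
    ContinuousOn f (Set.Icc 0 T) := by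
  have := (hf T hT).continuousOn
  rwa [Set.uIcc_of_le hT] at this

namespace HasACDeriv

variable {f g f' g' : ℝ → X}

theorem congr_deriv (hf : HasACDeriv f f') (h : ∀ᵐ t : ℝ, 0 < t → f' t = g' t) :
    HasACDeriv f g' := by
  refine ⟨hf.ac, ?_⟩
  filter_upwards [hf.deriv, h] with t h1 h2 ht
  rw [← h2 ht]
  exact h1 ht

theorem const (c : X) : HasACDeriv (fun _ => c) fun _ => 0 := by
  refine ⟨fun T _ => ?_, Eventually.of_forall fun t _ => hasDerivAt_const t c⟩
  simpa [AbsolutelyContinuousOnInterval] using tendsto_const_nhds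

theorem add (hf : HasACDeriv f f') (hg : HasACDeriv g g') :
    HasACDeriv (fun t => f t + g t) fun t => f' t + g' t := by
  refine ⟨fun T hT => (hf.ac T hT).fun_add (hg.ac T hT), ?_⟩
  filter_upwards [hf.deriv, hg.deriv] with t h1 h2 ht
  exact (h1 ht).add (h2 ht)

theorem sub (hf : HasACDeriv f f') (hg : HasACDeriv g g') :
    HasACDeriv (fun t => f t - g t) fun t => f' t - g' t := by
  refine ⟨fun T hT => (hf.ac T hT).fun_sub (hg.ac T hT), ?_⟩
  filter_upwards [hf.deriv, hg.deriv] with t h1 h2 ht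
  exact (h1 ht).sub (h2 ht)

theorem sum {ι : Type*} (s : Finset ι) {f f' : ι → ℝ → X}
    (hf : ∀ i ∈ s, HasACDeriv (f i) (f' i)) :
    HasACDeriv (fun t => ∑ i ∈ s, f i t) fun t => ∑ i ∈ s, f' i t := by
  classical
  induction s using Finset.induction_on with
  | empty => simpa using const (0 : X)
  | insert a s ha ih =>
    simp only [Finset.sum_insert ha]
    exact (hf a (Finset.mem_insert_self a s)).add
      (ih fun i hi => hf i (Finset.mem_insert_of_mem hi))

theorem clm (hf : HasACDeriv f f') (L : X →L[ℝ] Y) :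
    HasACDeriv (fun t => L (f t)) fun t => L (f' t) := by
  refine ⟨hf.ac.comp_lipschitz L.lipschitz, ?_⟩
  filter_upwards [hf.deriv] with t h1 ht
  exact L.hasFDerivAt.comp_hasDerivAt t (h1 ht)

theorem linearMap [FiniteDimensional ℝ X] (hf : HasACDeriv f f') (L : X →ₗ[ℝ] Y) :
    HasACDeriv (fun t => L (f t)) fun t => L (f' t) :=
  hf.clm (LinearMap.toContinuousLinearMap L)

theorem pi {ι : Type*} [Fintype ι] {V : ι → Type*} [∀ i, NormedAddCommGroup (V i)]
    [∀ i, NormedSpace ℝ (V i)] {f f' : ℝ → ∀ i, V i}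
    (hf : ∀ i, HasACDeriv (fun t => f t i) fun t => f' t i) : HasACDeriv f f' := by
  classical
  have h := sum Finset.univ (fun i _ => (hf i).clm (ContinuousLinearMap.single ℝ V i))
  have key : ∀ y : ∀ i, V i, ∑ i, ContinuousLinearMap.single ℝ V i (y i) = y := fun y => by
    simpa using Finset.univ_sum_single y
  simpa only [key] using h

theorem mul {f g f' g' : ℝ → ℝ} (hf : HasACDeriv f f') (hg : HasACDeriv g g') :
    HasACDeriv (fun t => f t * g t) fun t => f' t * g t + f t * g' t := by
  refine ⟨fun T hT => (hf.ac T hT).fun_mul (hg.ac T hT), ?_⟩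
  filter_upwards [hf.deriv, hg.deriv] with t h1 h2 ht
  exact (h1 ht).mul (h2 ht)

/-- Coordinates in an orthonormal basis reduce absolute continuity to that of products of real
functions; the derivative is the usual product rule. -/
theorem inner {V : Type*} [NormedAddCommGroup V] [InnerProductSpace ℝ V] [FiniteDimensional ℝ V]
    {f g f' g' : ℝ → V} (hf : HasACDeriv f f') (hg : HasACDeriv g g') :
    HasACDeriv (fun t => inner ℝ (f t) (g t))
      fun t => inner ℝ (f t) (g' t) + inner ℝ (f' t) (g t) := by
  let b := stdOrthonormalBasis ℝ V
  have h := sum Finset.univ (fun i _ =>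
    (hf.clm (innerSL ℝ (b i))).mul (hg.clm (innerSL ℝ (b i))))
  refine ⟨?_, ?_⟩
  · have key : ∀ x y : V, ∑ i, innerSL ℝ (b i) x * innerSL ℝ (b i) y = Inner.inner ℝ x y := by
      intro x y
      rw [← b.sum_inner_mul_inner x y]
      exact Finset.sum_congr rfl fun i _ => by
        rw [innerSL_apply_apply, innerSL_apply_apply, real_inner_comm]
    simpa only [key] using h.ac
  · filter_upwards [hf.deriv, hg.deriv] with t h1 h2 ht
    exact (h1 ht).inner ℝ (h2 ht)

theorem of_contDiff {f f' : ℝ → ℝ} (hf : ∀ t, HasDerivAt f (f' t) t) (hc : Continuous f') :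
    HasACDeriv f f' := by
  refine ⟨fun T hT => ?_, Eventually.of_forall fun t _ => hf t⟩
  obtain ⟨C, hC⟩ := (isCompact_uIcc (a := (0 : ℝ)) (b := T)).exists_bound_of_continuousOn
    hc.continuousOn
  refine LipschitzOnWith.absolutelyContinuousOnInterval (K := C.toNNReal) ?_
  refine (convex_uIcc 0 T).lipschitzOnWith_of_nnnorm_hasDerivWithin_le
    (fun t _ => (hf t).hasDerivWithinAt) fun t ht => ?_
  rw [← NNReal.coe_le_coe, coe_nnnorm]
  exact (hC t ht).trans (Real.le_coe_toNNReal C)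

/-- Absolute continuity gives the fundamental theorem of calculus, so an almost-everywhere sign of
the derivative suffices. All Lyapunov and comparison arguments rest on this. -/
theorem le_of_deriv_nonpos {f f' : ℝ → ℝ} (hf : HasACDeriv f f') {a b : ℝ} (ha : 0 ≤ a)
    (hab : a ≤ b) (h : ∀ᵐ t : ℝ, a < t → t ≤ b → f' t ≤ 0) : f b ≤ f a := by
  rw [← sub_nonpos, ← (hf.ac.mono_Icc ha hab).integral_deriv_eq_sub]
  rw [intervalIntegral.integral_of_le hab]
  refine setIntegral_nonpos_of_ae_restrict ?_
  rw [EventuallyLE, ae_restrict_iff' measurableSet_Ioc]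
  filter_upwards [hf.deriv, h] with t h1 h2 ht
  rw [(h1 (ha.trans_lt ht.1)).deriv]
  exact h2 ht.1 ht.2

theorem eq_of_deriv_zero {f : ℝ → X} (hf : HasACDeriv f fun _ => 0) {t : ℝ} (ht : 0 ≤ t) :
    f t = f 0 := by
  -- The derivative is only prescribed for `t > 0`; the endpoint is a null set.
  have h0 : ∀ᵐ t : ℝ, t ≠ 0 := by simp [ae_iff, measure_singleton]
  obtain ⟨C, hC⟩ := (hf.ac t ht).const_of_ae_hasDerivAt_zero (by
    filter_upwards [hf.deriv, h0] with s h1 h2 hs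
    rw [Set.uIcc_of_le ht] at hs
    exact h1 (lt_of_le_of_ne hs.1 h2.symm))
  rw [hC t Set.right_mem_uIcc, hC 0 Set.left_mem_uIcc]

end HasACDeriv

theorem LocallyAC.bounded_of_tendsto {X : Type*} [NormedAddCommGroup X] {f : ℝ → X}
    (hf : LocallyAC f) {c : X}
    (h : Tendsto f atTop (𝓝 c)) : ∃ M, ∀ t, 0 ≤ t → ‖f t‖ ≤ M := by
  obtain ⟨T, hT⟩ := eventually_atTop.1 (h.norm.eventually_le_const (lt_add_one ‖c‖))
  obtain ⟨C, hC⟩ := isCompact_Icc.exists_bound_of_continuousOn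
    (hf.continuousOn (le_max_right T 0))
  refine ⟨max C (‖c‖ + 1), fun t ht => ?_⟩
  rcases le_total t (max T 0) with h1 | h1
  · exact (hC t ⟨ht, h1⟩).trans (le_max_left _ _)
  · exact (hT t ((le_max_left _ _).trans h1)).trans (le_max_right _ _)

end Calculus

/-! ### Scalar comparison lemmas -/

/-- A nonnegative function with `f' ≤ -a f + g`, `g → 0`, tends to zero. -/
theorem tendsto_zero_of_deriv_le {f f' g : ℝ → ℝ} (hf : HasACDeriv f f') (hf0 : ∀ t, 0 ≤ f t)
    {a : ℝ} (ha : 0 < a) (h : ∀ᵐ t : ℝ, 0 < t → f' t ≤ -a * f t + g t)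
    (hg : Tendsto g atTop (𝓝 0)) : Tendsto f atTop (𝓝 0) := by
  rw [Metric.tendsto_atTop]
  intro η hη
  obtain ⟨T₀, hT₀⟩ := eventually_atTop.1 (hg.eventually_le_const (by positivity : 0 < a * (η / 2)))
  set T := max T₀ 0 with hT
  have hexp : HasACDeriv (fun t => Real.exp (a * (t - T))) fun t => a * Real.exp (a * (t - T)) := by
    refine .of_contDiff (fun t => ?_) (by fun_prop)
    have := (((hasDerivAt_id t).sub_const T).const_mul a).exp
    simpa [mul_comm] using this
  -- Integrating factor: beyond `T` one has `g ≤ a η / 2`, so `(f - η/2)' ≤ -a (f - η/2)`.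
  have hdec : ∀ t, T ≤ t → Real.exp (a * (t - T)) * (f t - η / 2) ≤ f T - η / 2 := by
    intro t ht
    have := (hexp.mul (hf.sub (.const (η / 2)))).le_of_deriv_nonpos
      (show 0 ≤ T from le_max_right T₀ 0) ht ?_
    · simpa using this
    · filter_upwards [h] with s hs h1 _
      have h2 := hs ((le_max_right T₀ 0).trans_lt h1)
      have h3 := hT₀ s ((le_max_left T₀ 0).trans h1.le)
      have h4 := Real.exp_pos (a * (s - T))
      nlinarith
  have hlim : Tendsto (fun t => Real.exp (-(a * (t - T))) * |f T - η / 2|) atTop (𝓝 0) := by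
    rw [← zero_mul |f T - η / 2|]
    refine Tendsto.mul_const _ (Real.tendsto_exp_neg_atTop_nhds_zero.comp ?_)
    exact (tendsto_atTop_add_const_right _ (-T) tendsto_id).const_mul_atTop ha
  obtain ⟨T₁, hT₁⟩ := eventually_atTop.1 (hlim.eventually_lt_const (half_pos hη))
  refine ⟨max T T₁, fun t ht => ?_⟩
  have h1 := hdec t ((le_max_left _ _).trans ht)
  have h2 := hT₁ t ((le_max_right _ _).trans ht)
  rw [Real.dist_eq, sub_zero, abs_of_nonneg (hf0 t)]
  have h3 : f t - η / 2 ≤ Real.exp (-(a * (t - T))) * |f T - η / 2| := by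
    have h4 := mul_le_mul_of_nonneg_left (h1.trans (le_abs_self _))
      (Real.exp_pos (-(a * (t - T)))).le
    rwa [← mul_assoc, ← Real.exp_add, neg_add_cancel, Real.exp_zero, one_mul] at h4
  linarith

/-- A nonnegative function whose slope is bounded below by `-C` and whose integral is bounded
tends to zero. -/
theorem tendsto_zero_of_integral_bounded {y y' Γ : ℝ → ℝ} (hy : HasACDeriv y y')
    (hy0 : ∀ t, 0 ≤ y t) {C : ℝ} (hC : ∀ᵐ t : ℝ, 0 < t → -C ≤ y' t) {φ : ℝ} (hφ : 0 < φ)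
    (hΓ : HasACDeriv Γ fun t => φ * y t) {M : ℝ} (hM : ∀ t, 0 ≤ t → Γ t ≤ M) :
    Tendsto y atTop (𝓝 0) := by
  wlog hC0 : 0 < C generalizing C
  · refine this (C := 1) ?_ one_pos
    filter_upwards [hC] with t h ht
    linarith [h ht]
  have hmono : ∀ s t, 0 ≤ s → s ≤ t → Γ s ≤ Γ t := by
    intro s t hs hst
    have := ((HasACDeriv.const (0 : ℝ)).sub hΓ).le_of_deriv_nonpos hs hst
      (Eventually.of_forall fun r _ _ => by have := mul_nonneg hφ.le (hy0 r); linarith)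
    linarith
  obtain ⟨l, hl⟩ : ∃ l, Tendsto Γ atTop (𝓝 l) := by
    -- Freezing `Γ` at its initial value for negative times makes it monotone on all of `ℝ`.
    have hm : Monotone fun t => Γ (max t 0) := fun s t hst =>
      hmono _ _ (le_max_right _ _) (max_le_max_right 0 hst)
    have hb : BddAbove (Set.range fun t => Γ (max t 0)) :=
      ⟨M, by rintro _ ⟨t, rfl⟩; exact hM _ (le_max_right _ _)⟩
    refine ⟨_, (tendsto_atTop_ciSup hm hb).congr' ?_⟩
    filter_upwards [eventually_ge_atTop 0] with t ht
    rw [max_eq_left ht]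
  rw [Metric.tendsto_atTop]
  intro η hη
  -- In time `h` the function `y` loses at most `C h = η / 2`. If `y t ≥ η`, then `Γ` grows by at
  -- least `φ (η / 2) h` on `[t, t + h]`, which contradicts its convergence for large `t`.
  set h := η / (2 * C) with hh
  have hhpos : 0 < h := by positivity
  have hCh : C * h = η / 2 := by rw [hh]; field_simp
  have hdiff : Tendsto (fun t => Γ (t + h) - Γ t) atTop (𝓝 0) := by
    have := (hl.comp (tendsto_atTop_add_const_right _ h tendsto_id)).sub hl
    simpa using this
  obtain ⟨T, hT⟩ := eventually_atTop.1
    (hdiff.eventually_lt_const (by positivity : 0 < φ * (η / 2) * h))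
  refine ⟨max T 0, fun t ht => ?_⟩
  have ht0 : 0 ≤ t := (le_max_right _ _).trans ht
  rw [Real.dist_eq, sub_zero, abs_of_nonneg (hy0 t)]
  by_contra! hcon
  have hlow : ∀ s, t ≤ s → s ≤ t + h → η / 2 ≤ y s := by
    intro s h1 h2
    have hid : HasACDeriv (fun t : ℝ => C * t) fun _ => C :=
      .of_contDiff (fun t => by simpa using (hasDerivAt_id t).const_mul C) continuous_const
    have := ((HasACDeriv.const (0 : ℝ)).sub (hy.add hid)).le_of_deriv_nonpos ht0 h1 (by
      filter_upwards [hC] with r hr h3 _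
      linarith [hr (ht0.trans_lt h3)])
    nlinarith
  have hid : HasACDeriv (fun t : ℝ => φ * (η / 2) * t) fun _ => φ * (η / 2) :=
    .of_contDiff (fun t => by simpa using (hasDerivAt_id t).const_mul (φ * (η / 2)))
      continuous_const
  have := (hid.sub hΓ).le_of_deriv_nonpos ht0 (by linarith : t ≤ t + h)
    (Eventually.of_forall fun r h1 h2 => by
      have := mul_le_mul_of_nonneg_left (hlow r h1.le h2) hφ.le
      linarith)
  have h3 := hT t ((le_max_left _ _).trans ht)
  nlinarith

/-! ### Hurwitz linear systems -/

theorem tendsto_zero_of_scalar_ode {y g : ℝ → ℂ} {μ : ℂ} (hμ : μ.re < 0)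
    (hy : HasACDeriv y fun t => μ * y t + g t) (hg : Tendsto g atTop (𝓝 0)) :
    Tendsto y atTop (𝓝 0) := by
  have hn : HasACDeriv (fun t => ‖y t‖ ^ 2)
      fun t => 2 * (μ.re * ‖y t‖ ^ 2 + inner ℝ (y t) (g t)) := by
    have h := hy.inner hy
    simp only [real_inner_self_eq_norm_sq] at h
    refine h.congr_deriv (Eventually.of_forall fun t _ => ?_)
    rw [real_inner_comm (y t), inner_add_right]
    have : inner ℝ (y t) (μ * y t) = μ.re * ‖y t‖ ^ 2 := by
      rw [Complex.inner, mul_assoc, Complex.mul_conj, Complex.normSq_eq_norm_sq,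
        Complex.re_mul_ofReal]
    rw [this]
    ring
  have hsq : Tendsto (fun t => ‖y t‖ ^ 2) atTop (𝓝 0) := by
    -- Young's inequality with `a = -μ.re`: `2⟪y, g⟫ ≤ a ‖y‖² + a⁻¹ ‖g‖²`, which uses up half of the
    -- decay rate `2a`.
    refine tendsto_zero_of_deriv_le hn (fun t => by positivity) (a := -μ.re) (by linarith)
      (g := fun t => (-μ.re)⁻¹ * ‖g t‖ ^ 2) (Eventually.of_forall fun t _ => ?_) ?_
    · have h1 := (abs_le.1 (abs_real_inner_le_norm (y t) (g t))).2
      have ha : 0 < -μ.re := by linarith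
      have h2 : 0 ≤ (-μ.re)⁻¹ * (-μ.re * ‖y t‖ - ‖g t‖) ^ 2 := by positivity
      have h3 : (-μ.re)⁻¹ * (-μ.re * ‖y t‖ - ‖g t‖) ^ 2
          = -μ.re * ‖y t‖ ^ 2 - 2 * (‖y t‖ * ‖g t‖) + (-μ.re)⁻¹ * ‖g t‖ ^ 2 := by
        have := mul_inv_cancel₀ ha.ne'
        generalize (-μ.re)⁻¹ = b at *
        linear_combination (-μ.re * ‖y t‖ ^ 2 - 2 * ‖y t‖ * ‖g t‖) * this
      linarith
    · simpa using (hg.norm.pow 2).const_mul (-μ.re)⁻¹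
  rw [tendsto_zero_iff_norm_tendsto_zero]
  simpa [Real.sqrt_sq] using hsq.sqrt

/-- Peel off one root at a time: `w = (M - μ) y` solves the same equation and is killed by the
remaining product, so `w → 0` by induction. Each coordinate of `y` then solves `ẏ = μ y + w`. No
Jordan form or matrix exponential is needed; Cayley–Hamilton supplies the annihilating product. -/
theorem tendsto_zero_of_aeval_prod_eq_zero {k : ℕ} (M : Matrix (Fin k) (Fin k) ℂ)
    (s : Multiset ℂ) (hs : ∀ μ ∈ s, μ.re < 0) {y : ℝ → Fin k → ℂ}
    (hy : HasACDeriv y fun t => M.mulVec (y t))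
    (h0 : ∀ t, (Polynomial.aeval M
      (s.map fun μ => Polynomial.X - Polynomial.C μ).prod).mulVec (y t) = 0) :
    Tendsto y atTop (𝓝 0) := by
  induction s using Multiset.induction_on generalizing y with
  | empty =>
    have : y = fun _ => 0 := funext fun t => by simpa using h0 t
    rw [this]
    exact tendsto_const_nhds
  | cons μ s ih =>
    have hw : HasACDeriv (fun t => M.mulVec (y t) - μ • y t)
        fun t => M.mulVec (M.mulVec (y t) - μ • y t) := by
      have h := hy.linearMap ((Matrix.toLin' M - μ • LinearMap.id).restrictScalars ℝ)
      simpa [Matrix.mulVec_sub, Matrix.mulVec_smul] using h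
    have hw0 : Tendsto (fun t => M.mulVec (y t) - μ • y t) atTop (𝓝 0) := by
      refine ih (fun ν hν => hs ν (Multiset.mem_cons_of_mem hν)) hw fun t => ?_
      rw [← h0 t, Multiset.map_cons, Multiset.prod_cons, mul_comm, map_mul,
        ← Matrix.mulVec_mulVec]
      congr 1
      simp [Matrix.sub_mulVec, Algebra.algebraMap_eq_smul_one, Matrix.smul_mulVec]
    rw [tendsto_pi_nhds] at hw0 ⊢
    intro i
    refine tendsto_zero_of_scalar_ode (hs μ (Multiset.mem_cons_self μ s)) ?_ (hw0 i)
    have h := hy.clm (ContinuousLinearMap.proj (R := ℝ) (φ := fun _ : Fin k => ℂ) i)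
    simpa using h

/-- Solutions of `ẏ = E y` with `E` Hurwitz tend to zero. -/
theorem IsHurwitz.tendsto_zero {k : ℕ} {E : Matrix (Fin k) (Fin k) ℝ} (hE : IsHurwitz E)
    {y : ℝ → Vec k} (hy : HasACDeriv y fun t => E *ₑ y t) : Tendsto y atTop (𝓝 0) := by
  set M := E.map (algebraMap ℝ ℂ) with hM
  have hY : HasACDeriv (fun t (i : Fin k) => (y t i : ℂ))
      fun t => M.mulVec fun i => (y t i : ℂ) := by
    refine HasACDeriv.pi fun i => ?_
    have h := (hy.clm (EuclideanSpace.proj i : Vec k →L[ℝ] ℝ)).clm Complex.ofRealCLM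
    simpa [Matrix.mulVec, dotProduct, hM] using h
  have h0 := tendsto_zero_of_aeval_prod_eq_zero M M.charpoly.roots (fun μ hμ => hE μ ?_) hY ?_
  · rw [tendsto_pi_nhds] at h0
    have h1 : Tendsto (fun t => (WithLp.ofLp (y t) : Fin k → ℝ)) atTop (𝓝 0) := by
      rw [tendsto_pi_nhds]
      intro i
      have := (Complex.continuous_re.tendsto _).comp (h0 i)
      simpa [Function.comp_def] using this
    have := ((PiLp.continuous_toLp 2 (fun _ : Fin k => ℝ)).tendsto _).comp h1
    simpa [Function.comp_def] using this
  · rw [← hM]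
    exact Matrix.mem_spectrum_of_isRoot_charpoly (Polynomial.isRoot_of_mem_roots hμ)
  · intro t
    rw [← (IsAlgClosed.splits M.charpoly).eq_prod_roots_of_monic M.charpoly_monic,
      Matrix.aeval_self_charpoly, Matrix.zero_mulVec]


/-! ### Convergence of the adaptive sliding-mode law -/

section Adaptive

variable {ι : Type*} [Fintype ι] {V : ι → Type*} [∀ i, NormedAddCommGroup (V i)]

theorem norm_le_sum_norm (x : PiLp 2 V) : ‖x‖ ≤ ∑ i, ‖x i‖ := by
  rw [← abs_of_nonneg (norm_nonneg x),
    ← abs_of_nonneg (Finset.sum_nonneg fun i (_ : i ∈ Finset.univ) => norm_nonneg (x i)),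
    ← sq_le_sq, PiLp.norm_sq_eq_of_L2]
  exact Finset.sum_sq_le_sq_sum_of_nonneg fun i _ => norm_nonneg _

variable [∀ i, InnerProductSpace ℝ (V i)]

/-- A positive semidefinite operator satisfies `‖P x‖² ≤ c ⟪P x, x⟫`. -/
theorem exists_norm_sq_le_of_posSemidef {H : Type*} [NormedAddCommGroup H] [InnerProductSpace ℝ H]
    [FiniteDimensional ℝ H] (P : H →ₗ[ℝ] H) (hsymm : P.IsSymmetric)
    (hpos : ∀ x, 0 ≤ inner ℝ (P x) x) :
    ∃ c, 0 ≤ c ∧ ∀ x, ‖P x‖ ^ 2 ≤ c * inner ℝ (P x) x := by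
  let L := LinearMap.toContinuousLinearMap P
  refine ⟨‖L‖, norm_nonneg _, fun x => ?_⟩
  let Bf : LinearMap.BilinForm ℝ H := (innerₗ H).comp P
  -- Cauchy–Schwarz for the semidefinite form `⟪P ·, ·⟫`, applied to `x` and `P x`.
  have h := Bf.apply_sq_le_of_symm hpos
    ⟨fun x y => by simpa [Bf] using (hsymm x y).trans (real_inner_comm _ _)⟩ x (P x)
  have h' : inner ℝ (P x) (P x) ^ 2 ≤ inner ℝ (P x) x * inner ℝ (P (P x)) (P x) := h
  have h2 : inner ℝ (P (P x)) (P x) ≤ ‖L‖ * ‖P x‖ ^ 2 := by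
    refine (real_inner_le_norm _ _).trans ?_
    rw [pow_two, ← mul_assoc]
    exact mul_le_mul_of_nonneg_right (L.le_opNorm (P x)) (norm_nonneg _)
  rw [real_inner_self_eq_norm_sq] at h'
  rcases eq_or_ne (P x) 0 with h0 | h0
  · simp [h0]
  · have h3 : 0 < ‖P x‖ ^ 2 := by positivity
    have h4 := mul_le_mul_of_nonneg_left h2 (hpos x)
    nlinarith

/-- The Filippov selection `s` enters only through `‖s‖ ≤ 1` and `⟪P ζ i, s⟫ = ‖P ζ i‖`. The
constants `K₁`, `K₂` serve as virtual target gains: the adaptive laws need not know them, yet they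
dominate the drift in the Lyapunov estimate. -/
theorem adaptive_convergence [∀ i, FiniteDimensional ℝ (V i)]
    (P : PiLp 2 V →ₗ[ℝ] PiLp 2 V) (hsymm : P.IsSymmetric) (hpos : ∀ x, 0 ≤ inner ℝ (P x) x)
    {ζ ζ' f : ℝ → PiLp 2 V} {γ γs : ι → ℝ → ℝ} {φ φs : ι → ℝ} {K₁ K₂ : ℝ}
    (hφ : ∀ i, 0 < φ i) (hφs : ∀ i, 0 < φs i) (hK₂ : 0 ≤ K₂)
    (hζ : HasACDeriv ζ ζ')
    (hζ' : ∀ᵐ t : ℝ, 0 < t → ∀ i, ∃ s : V i, ‖s‖ ≤ 1 ∧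
      inner ℝ (P (ζ t) i) s = ‖P (ζ t) i‖ ∧ ζ' t i = f t i - (γ i t • P (ζ t) i + γs i t • s))
    (hf : ∀ t, 0 ≤ t → ‖f t‖ ≤ K₁ * ‖P (ζ t)‖ + K₂)
    (hγ : ∀ i, HasACDeriv (γ i) fun t => φ i * ‖P (ζ t) i‖ ^ 2)
    (hγs : ∀ i, HasACDeriv (γs i) fun t => φs i * ‖P (ζ t) i‖) :
    Tendsto (fun t => P (ζ t)) atTop (𝓝 0) ∧
      ∀ i, ∃ M : ℝ, ∀ t, 0 ≤ t → |γ i t| ≤ M ∧ |γs i t| ≤ M := by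
  have hε := hζ.linearMap P
  have hVdiff : HasACDeriv (fun t => (1 / 2) * inner ℝ (P (ζ t)) (ζ t) +
      ∑ i, ((2 * φ i)⁻¹ * ((γ i t - K₁) * (γ i t - K₁)) +
        (2 * φs i)⁻¹ * ((γs i t - K₂) * (γs i t - K₂))))
      fun t => inner ℝ (P (ζ t)) (ζ' t) +
        ∑ i, ((γ i t - K₁) * ‖P (ζ t) i‖ ^ 2 + (γs i t - K₂) * ‖P (ζ t) i‖) := by
    have h1 := (hε.inner hζ).linearMap (LinearMap.mulLeft ℝ (1 / 2 : ℝ))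
    have h2 := fun i => (hγ i).sub (.const K₁)
    have h3 := fun i => (hγs i).sub (.const K₂)
    have h4 := HasACDeriv.sum Finset.univ fun i _ =>
      (((h2 i).mul (h2 i)).linearMap (LinearMap.mulLeft ℝ (2 * φ i)⁻¹)).add
      (((h3 i).mul (h3 i)).linearMap (LinearMap.mulLeft ℝ (2 * φs i)⁻¹))
    refine (h1.add h4).congr_deriv (Eventually.of_forall fun t _ => ?_)
    simp only [LinearMap.mulLeft_apply, sub_zero]
    congr 1
    · rw [hsymm (ζ' t) (ζ t), real_inner_comm]
      ring
    · refine Finset.sum_congr rfl fun i _ => ?_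
      have := (hφ i).ne'
      have := (hφs i).ne'
      field_simp
      ring
  set W : ℝ → ℝ := fun t => (1 / 2) * inner ℝ (P (ζ t)) (ζ t) +
      ∑ i, ((2 * φ i)⁻¹ * ((γ i t - K₁) * (γ i t - K₁)) +
        (2 * φs i)⁻¹ * ((γs i t - K₂) * (γs i t - K₂))) with hW
  have hWle : ∀ t, 0 ≤ t → W t ≤ W 0 := by
    intro t ht
    refine hVdiff.le_of_deriv_nonpos le_rfl ht ?_
    filter_upwards [hζ'] with t h h0 _
    -- The constant part of the drift is bounded by the sum of the blockwise norms, the form in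
    -- which the sliding gains `γs i` act.
    have hf' : inner ℝ (P (ζ t)) (f t) ≤
        K₁ * ‖P (ζ t)‖ ^ 2 + K₂ * ∑ i, ‖P (ζ t) i‖ := by
      have h1 := real_inner_le_norm (P (ζ t)) (f t)
      have h2 := mul_le_mul_of_nonneg_left (hf t h0.le) (norm_nonneg (P (ζ t)))
      have h3 := mul_le_mul_of_nonneg_left (norm_le_sum_norm (P (ζ t))) hK₂
      nlinarith
    have hinner : inner ℝ (P (ζ t)) (ζ' t) = inner ℝ (P (ζ t)) (f t) -
        ∑ i, (γ i t * ‖P (ζ t) i‖ ^ 2 + γs i t * ‖P (ζ t) i‖) := by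
      rw [PiLp.inner_apply, PiLp.inner_apply, ← Finset.sum_sub_distrib]
      refine Finset.sum_congr rfl fun i _ => ?_
      obtain ⟨s, -, h2, h3⟩ := h h0 i
      rw [h3, inner_sub_right, inner_add_right, real_inner_smul_right, real_inner_smul_right, h2,
        real_inner_self_eq_norm_sq]
    rw [PiLp.norm_sq_eq_of_L2, Finset.mul_sum, Finset.mul_sum, ← Finset.sum_add_distrib] at hf'
    have hsum : ∑ i, ((γ i t - K₁) * ‖P (ζ t) i‖ ^ 2 + (γs i t - K₂) * ‖P (ζ t) i‖) =
        ∑ i, (γ i t * ‖P (ζ t) i‖ ^ 2 + γs i t * ‖P (ζ t) i‖) -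
        ∑ i, (K₁ * ‖P (ζ t) i‖ ^ 2 + K₂ * ‖P (ζ t) i‖) := by
      rw [← Finset.sum_sub_distrib]
      exact Finset.sum_congr rfl fun i _ => by ring
    rw [hinner, hsum]
    linarith
  have hterm : ∀ t i, 0 ≤ (2 * φ i)⁻¹ * ((γ i t - K₁) * (γ i t - K₁)) ∧
      0 ≤ (2 * φs i)⁻¹ * ((γs i t - K₂) * (γs i t - K₂)) := fun t i =>
    ⟨mul_nonneg (by have := hφ i; positivity) (mul_self_nonneg _),
      mul_nonneg (by have := hφs i; positivity) (mul_self_nonneg _)⟩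
  have hsumle : ∀ t i, (2 * φ i)⁻¹ * ((γ i t - K₁) * (γ i t - K₁)) +
        (2 * φs i)⁻¹ * ((γs i t - K₂) * (γs i t - K₂)) ≤ W t := by
    intro t i
    have h1 := Finset.single_le_sum (fun j _ => add_nonneg (hterm t j).1 (hterm t j).2)
      (Finset.mem_univ i)
    have h2 := hpos (ζ t)
    simp only [hW]
    linarith
  -- A crude bound through `r ≤ r² + 1`, which avoids square roots.
  have hbound : ∀ {a K φ w : ℝ}, 0 < φ → (2 * φ)⁻¹ * ((a - K) * (a - K)) ≤ w →
      |a| ≤ |K| + (2 * φ * w + 1) := by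
    intro a K φ w hφ h
    rw [inv_mul_le_iff₀ (by positivity)] at h
    have h1 : |a - K| ≤ 2 * φ * w + 1 := by
      rw [← abs_mul_abs_self] at h
      nlinarith [sq_nonneg (|a - K| - 1), abs_nonneg (a - K)]
    have h2 := abs_add_le (a - K) K
    rw [sub_add_cancel] at h2
    linarith
  have hgain : ∀ i, ∃ M : ℝ, ∀ t, 0 ≤ t → |γ i t| ≤ M ∧ |γs i t| ≤ M := by
    intro i
    refine ⟨max (|K₁| + (2 * φ i * W 0 + 1)) (|K₂| + (2 * φs i * W 0 + 1)), fun t ht => ?_⟩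
    have h1 := (hsumle t i).trans (hWle t ht)
    exact ⟨(hbound (hφ i) (by linarith [(hterm t i).2])).trans (le_max_left _ _),
      (hbound (hφs i) (by linarith [(hterm t i).1])).trans (le_max_right _ _)⟩
  refine ⟨?_, hgain⟩
  obtain ⟨c, hc, hPc⟩ := exists_norm_sq_le_of_posSemidef P hsymm hpos
  obtain ⟨b, hb0, hb⟩ : ∃ b, 0 ≤ b ∧ ∀ t, 0 ≤ t → ‖P (ζ t)‖ ≤ b := by
    refine ⟨c * (2 * W 0) + 1, ?_, fun t ht => ?_⟩
    · have : 0 ≤ W 0 := by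
        have := hpos (ζ 0)
        have := Finset.sum_nonneg fun i (_ : i ∈ Finset.univ) =>
          add_nonneg (hterm 0 i).1 (hterm 0 i).2
        simp only [hW]
        linarith
      positivity
    · have h1 : inner ℝ (P (ζ t)) (ζ t) ≤ 2 * W 0 := by
        have h2 := hWle t ht
        have := Finset.sum_nonneg fun i (_ : i ∈ Finset.univ) =>
          add_nonneg (hterm t i).1 (hterm t i).2
        simp only [hW] at h2 ⊢
        linarith
      have h3 := (hPc (ζ t)).trans (mul_le_mul_of_nonneg_left h1 hc)
      nlinarith [sq_nonneg (‖P (ζ t)‖ - 1), norm_nonneg (P (ζ t))]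
  choose M hM using hgain
  -- With gains and `P ζ` bounded, `ζ'` is bounded; this is the slope bound the Barbalat argument
  -- requires.
  obtain ⟨C, hC0, hC⟩ : ∃ C, 0 ≤ C ∧ ∀ᵐ t : ℝ, 0 < t → ‖P (ζ' t)‖ ≤ C := by
    let L := LinearMap.toContinuousLinearMap P
    refine ⟨‖L‖ * ∑ i, (|K₁| * b + K₂ + (|M i| * b + |M i|)), by positivity, ?_⟩
    filter_upwards [hζ'] with t h ht
    refine (L.le_opNorm (ζ' t)).trans (mul_le_mul_of_nonneg_left ?_ (norm_nonneg _))
    refine (norm_le_sum_norm _).trans (Finset.sum_le_sum fun i _ => ?_)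
    obtain ⟨s, h1, -, h3⟩ := h ht i
    have hbt := hb t ht.le
    have hMt := hM i t ht.le
    rw [h3]
    refine (norm_sub_le _ _).trans (add_le_add ?_ ((norm_add_le _ _).trans (add_le_add ?_ ?_)))
    · refine ((PiLp.norm_apply_le (f t) i).trans (hf t ht.le)).trans ?_
      have h4 := mul_le_mul (le_abs_self K₁) hbt (norm_nonneg _) (abs_nonneg _)
      linarith
    · rw [norm_smul, Real.norm_eq_abs]
      exact mul_le_mul (hMt.1.trans (le_abs_self _)) ((PiLp.norm_apply_le _ i).trans hbt)
        (norm_nonneg _) (abs_nonneg _)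
    · rw [norm_smul, Real.norm_eq_abs]
      calc |γs i t| * ‖s‖ ≤ |M i| * 1 :=
            mul_le_mul (hMt.2.trans (le_abs_self _)) h1 (norm_nonneg _) (abs_nonneg _)
        _ = |M i| := mul_one _
  have hcomp : ∀ i, Tendsto (fun t => ‖P (ζ t) i‖ ^ 2) atTop (𝓝 0) := by
    intro i
    have hεi := hε.clm (PiLp.proj 2 V i : PiLp 2 V →L[ℝ] V i)
    have hy := hεi.inner hεi
    simp only [PiLp.proj_apply, real_inner_self_eq_norm_sq] at hy
    refine tendsto_zero_of_integral_bounded (C := 2 * (b * C)) hy (fun t => by positivity) ?_ (hφ i)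
      (hγ i) (M := M i) fun t ht => (le_abs_self _).trans (hM i t ht).1
    filter_upwards [hC] with t h ht
    rw [real_inner_comm (P (ζ t) i)]
    have h1 := (abs_le.1 (abs_real_inner_le_norm (P (ζ t) i) (P (ζ' t) i))).1
    have h2 : ‖P (ζ t) i‖ * ‖P (ζ' t) i‖ ≤ b * C :=
      mul_le_mul ((PiLp.norm_apply_le _ i).trans (hb t ht.le))
        ((PiLp.norm_apply_le _ i).trans (h ht)) (norm_nonneg _) hb0
    linarith
  rw [tendsto_zero_iff_norm_tendsto_zero]
  have h := tendsto_finsetSum Finset.univ fun i _ => hcomp i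
  simp only [← PiLp.norm_sq_eq_of_L2, Finset.sum_const_zero] at h
  simpa [Real.sqrt_sq] using h.sqrt

end Adaptive


/-! ### Matrix-vector algebra on Euclidean spaces -/

section Matrices

variable {a b c : ℕ}

theorem mulE_mulE (M : Matrix (Fin a) (Fin b) ℝ) (N : Matrix (Fin b) (Fin c) ℝ) (x : Vec c) :
    M *ₑ N *ₑ x = (M * N) *ₑ x := by
  simp [mulE, Matrix.toLpLin_apply]

theorem one_mulE (x : Vec a) : (1 : Matrix (Fin a) (Fin a) ℝ) *ₑ x = x := by
  simp [mulE]

theorem zero_mulE (x : Vec b) : (0 : Matrix (Fin a) (Fin b) ℝ) *ₑ x = 0 := by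
  simp [mulE]

theorem add_mulE (M N : Matrix (Fin a) (Fin b) ℝ) (x : Vec b) :
    (M + N) *ₑ x = M *ₑ x + N *ₑ x := by
  simp [mulE]

theorem sub_mulE (M N : Matrix (Fin a) (Fin b) ℝ) (x : Vec b) :
    (M - N) *ₑ x = M *ₑ x - N *ₑ x := by
  simp [mulE]

open Matrix in
theorem inner_transpose_mulE (M : Matrix (Fin a) (Fin b) ℝ) (x : Vec a) (y : Vec b) :
    inner ℝ (Mᵀ *ₑ x) y = inner ℝ x (M *ₑ y) := by
  rw [← Matrix.conjTranspose_eq_transpose_of_trivial, mulE, mulE,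
    Matrix.toEuclideanLin_conjTranspose_eq_adjoint, LinearMap.adjoint_inner_left]

end Matrices

/-! ### The projected graph Laplacian -/

section Laplacian

variable {n N : ℕ}

/-- Summation by parts: exchanging `i` and `j` flips the sign of `X i - X j` and preserves the
symmetric weights. -/
theorem WeightedGraph.sum_inner_laplacian (𝒢 : WeightedGraph N) {V : Type*} [NormedAddCommGroup V]
    [InnerProductSpace ℝ V] (X Y : Fin N → V) :
    ∑ i, inner ℝ (∑ j, 𝒢.weight i j • (X i - X j)) (Y i) =
      (1 / 2) * ∑ i, ∑ j, 𝒢.weight i j * inner ℝ (X i - X j) (Y i - Y j) := by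
  have h1 : ∑ i, inner ℝ (∑ j, 𝒢.weight i j • (X i - X j)) (Y i) =
      ∑ i, ∑ j, 𝒢.weight i j * inner ℝ (X i - X j) (Y i) := by
    simp only [sum_inner, real_inner_smul_left]
  have h2 : ∑ i, ∑ j, 𝒢.weight i j * inner ℝ (X i - X j) (Y j) =
      -∑ i, ∑ j, 𝒢.weight i j * inner ℝ (X i - X j) (Y i) := by
    rw [Finset.sum_comm, ← Finset.sum_neg_distrib]
    refine Finset.sum_congr rfl fun i _ => ?_
    rw [← Finset.sum_neg_distrib]
    refine Finset.sum_congr rfl fun j _ => ?_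
    rw [𝒢.symm j i, ← neg_sub (X i) (X j), inner_neg_left]
    ring
  simp only [inner_sub_right (𝕜 := ℝ) (_ - _), mul_sub, Finset.sum_sub_distrib]
  rw [h1, h2]
  ring

theorem WeightedGraph.Connected.eq_of_sum_eq_zero {𝒢 : WeightedGraph N} (h𝒢 : 𝒢.Connected)
    {V : Type*} [NormedAddCommGroup V] [InnerProductSpace ℝ V] {X : Fin N → V}
    (h : ∑ i, ∑ j, 𝒢.weight i j * inner ℝ (X i - X j) (X i - X j) = 0) (i j : Fin N) :
    X i = X j := by
  have hnn : ∀ i j, 0 ≤ 𝒢.weight i j * inner ℝ (X i - X j) (X i - X j) := fun i j =>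
    mul_nonneg (𝒢.nonneg i j) real_inner_self_nonneg
  have hedge : ∀ k l, 0 < 𝒢.weight l k → X k = X l := by
    intro k l hkl
    have h1 := (Finset.sum_eq_zero_iff_of_nonneg
      fun i _ => Finset.sum_nonneg fun j _ => hnn i j).1 h l (Finset.mem_univ l)
    have h2 := (Finset.sum_eq_zero_iff_of_nonneg fun j _ => hnn l j).1 h1 k (Finset.mem_univ k)
    have h3 := (mul_eq_zero.1 h2).resolve_left hkl.ne'
    exact (sub_eq_zero.1 (inner_self_eq_zero.1 h3)).symm
  induction h𝒢 i j with
  | refl => rfl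
  | tail _ h ih => exact ih.trans (hedge _ _ h)

variable {k : Fin N → ℕ} (𝒢 : WeightedGraph N) (Tu : ∀ i, Matrix (Fin n) (Fin (k i)) ℝ)

/-- The consensus errors of all nodes, as a linear map of the estimates. -/
noncomputable def consensusMap : (Fin N → Vec n) →ₗ[ℝ] PiLp 2 fun i => Vec (k i) where
  toFun X := WithLp.toLp 2 fun i => consensusError 𝒢 (Tu i) X i
  map_add' X Y := by
    ext1 i
    simp only [consensusError, PiLp.add_apply, Pi.add_apply, ← map_add, ← Finset.sum_add_distrib]
    congr 1
    exact Finset.sum_congr rfl fun j _ => by module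
  map_smul' c X := by
    ext1 i
    simp only [consensusError, PiLp.smul_apply, Pi.smul_apply, ← map_smul, Finset.smul_sum,
      RingHom.id_apply]
    congr 1
    exact Finset.sum_congr rfl fun j _ => by module

/-- Block-diagonal multiplication by the matrices `T_{iu}`. -/
noncomputable def liftMap : (PiLp 2 fun i => Vec (k i)) →ₗ[ℝ] (Fin N → Vec n) where
  toFun w i := Tu i *ₑ w i
  map_add' w w' := by
    ext1 i
    simp
  map_smul' c w := by
    ext1 i
    simp

theorem inner_consensusMap_liftMap (w w' : PiLp 2 fun i => Vec (k i)) :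
    inner ℝ (consensusMap 𝒢 Tu (liftMap Tu w)) w' = (1 / 2) * ∑ i, ∑ j, 𝒢.weight i j *
      inner ℝ (liftMap Tu w i - liftMap Tu w j) (liftMap Tu w' i - liftMap Tu w' j) := by
  rw [← 𝒢.sum_inner_laplacian, PiLp.inner_apply]
  exact Finset.sum_congr rfl fun i _ => inner_transpose_mulE _ _ _

/-- The projected Laplacian `T_uᵀ (L ⊗ I) T_u`. -/
noncomputable def projectedLaplacian :
    (PiLp 2 fun i => Vec (k i)) →ₗ[ℝ] (PiLp 2 fun i => Vec (k i)) :=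
  consensusMap 𝒢 Tu ∘ₗ liftMap Tu

theorem projectedLaplacian_isSymmetric : (projectedLaplacian 𝒢 Tu).IsSymmetric := by
  intro w w'
  rw [real_inner_comm _ w]
  simp only [projectedLaplacian, LinearMap.comp_apply, inner_consensusMap_liftMap]
  congr 1
  exact Finset.sum_congr rfl fun i _ => Finset.sum_congr rfl fun j _ => by rw [real_inner_comm]

theorem projectedLaplacian_nonneg (w : PiLp 2 fun i => Vec (k i)) :
    0 ≤ inner ℝ (projectedLaplacian 𝒢 Tu w) w := by
  simp only [projectedLaplacian, LinearMap.comp_apply, inner_consensusMap_liftMap]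
  exact mul_nonneg (by norm_num) (Finset.sum_nonneg fun i _ => Finset.sum_nonneg fun j _ =>
    mul_nonneg (𝒢.nonneg i j) real_inner_self_nonneg)

/-- On the kernel the Dirichlet energy vanishes, so by connectedness all `Tu i *ₑ w i` equal one
vector. It is orthogonal to the image of every `Td j`; these images span the space, so it is zero.
-/
theorem projectedLaplacian_injective {δ : Fin N → ℕ} {𝒢 : WeightedGraph N} (h𝒢 : 𝒢.Connected)
    {Td : ∀ i, Matrix (Fin n) (Fin (δ i)) ℝ} (hdet : CollectivelyStronglyDetectable Td)
    {Tu : ∀ i, Matrix (Fin n) (Fin (n - δ i)) ℝ} (hTu : ∀ i, IsComplementBasis (Td i) (Tu i)) :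
    Function.Injective (projectedLaplacian 𝒢 Tu) := by
  rw [← LinearMap.ker_eq_bot, LinearMap.ker_eq_bot']
  intro w hw
  have h0 : inner ℝ (projectedLaplacian 𝒢 Tu w) w = 0 := by rw [hw, inner_zero_left]
  simp only [projectedLaplacian, LinearMap.comp_apply, inner_consensusMap_liftMap] at h0
  have heq := h𝒢.eq_of_sum_eq_zero ((mul_eq_zero.1 h0).resolve_left (by norm_num))
  ext1 i
  have hperp : liftMap Tu w i = 0 := by
    have hle : ⨆ j, LinearMap.range (Matrix.toEuclideanLin (Td j)) ≤
        (Submodule.span ℝ {liftMap Tu w i})ᗮ := by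
      refine iSup_le fun j => ?_
      rintro _ ⟨y, rfl⟩
      rw [Submodule.mem_orthogonal_singleton_iff_inner_right, heq i j]
      change inner ℝ _ (Td j *ₑ y) = 0
      rw [← inner_transpose_mulE]
      change inner ℝ ((Td j).transpose *ₑ Tu j *ₑ w j) y = 0
      rw [mulE_mulE, (hTu j).orthogonal, zero_mulE, inner_zero_left]
    have hmem : liftMap Tu w i ∈ (Submodule.span ℝ {liftMap Tu w i})ᗮ := by
      refine hle ?_
      rw [show ⨆ j, LinearMap.range (Matrix.toEuclideanLin (Td j)) = ⊤ from hdet]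
      trivial
    rw [Submodule.mem_orthogonal_singleton_iff_inner_right] at hmem
    exact inner_self_eq_zero.1 hmem
  have h1 : (Tu i).transpose *ₑ liftMap Tu w i = w i := by
    change (Tu i).transpose *ₑ Tu i *ₑ w i = w i
    rw [mulE_mulE, (hTu i).orthonormal, one_mulE]
  rw [← h1, hperp]
  exact map_zero (Matrix.toEuclideanLin (Tu i).transpose)

end Laplacian

/-! ### Error dynamics of a single node -/

section ErrorDynamics

open Matrix

variable {n p r ml δ : ℕ} {A : Matrix (Fin n) (Fin n) ℝ} {Bl : Matrix (Fin n) (Fin ml) ℝ}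
  {Bm : Matrix (Fin n) (Fin r) ℝ}
  {C : Matrix (Fin p) (Fin n) ℝ} {q : Quadruple n p δ} {Tu : Matrix (Fin n) (Fin (n - δ)) ℝ}

theorem IsComplementBasis.transpose_mul_Td {Td : Matrix (Fin n) (Fin δ) ℝ}
    (h : IsComplementBasis Td Tu) : Tuᵀ * Td = 0 := by
  have := congrArg Matrix.transpose h.orthogonal
  simpa using this

theorem IsComplementBasis.decomp {Td : Matrix (Fin n) (Fin δ) ℝ}
    (h : IsComplementBasis Td Tu) (e : Vec n) : Td *ₑ Tdᵀ *ₑ e + Tu *ₑ Tuᵀ *ₑ e = e := by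
  rw [mulE_mulE, mulE_mulE, h.complement, sub_mulE, one_mulE, add_sub_cancel]

/-- The detectable part of the estimation error obeys an autonomous linear equation. -/
theorem detectable_error_deriv (hq : q ∈ Omega A Bm C δ) (hTu : IsComplementBasis q.Td Tu)
    (x z : Vec n) (ul : Vec ml) (um : Vec r) (w : Vec (n - δ)) :
    q.Tdᵀ *ₑ ((Ebar A q Tu *ₑ z + Fbar A q Tu *ₑ (C *ₑ x) + Bbar C Bl q *ₑ ul - Tu *ₑ w)
        + Gbar q *ₑ (C *ₑ (A *ₑ x + (Bl *ₑ ul + Bm *ₑ um)))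
        - (A *ₑ x + (Bl *ₑ ul + Bm *ₑ um))) =
      q.E *ₑ q.Tdᵀ *ₑ (estimate C q z x - x) := by
  obtain ⟨h1, h2, h3, -⟩ := hq
  have hE : q.Tdᵀ * Ebar A q Tu = q.E * q.Tdᵀ := by
    simp only [Ebar, Matrix.mul_add, ← Matrix.mul_assoc, h1, hTu.orthogonal, Matrix.one_mul,
      Matrix.zero_mul, add_zero]
  have hG : q.Tdᵀ * Gbar q = q.G := by
    simp only [Gbar, ← Matrix.mul_assoc, h1, Matrix.one_mul]
  have hF : q.Tdᵀ * Fbar A q Tu = q.F := by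
    simp only [Fbar, Matrix.mul_add, ← Matrix.mul_assoc, h1, hTu.orthogonal, Matrix.one_mul,
      Matrix.zero_mul, add_zero]
  have hB : q.Tdᵀ * Bbar C Bl q = q.Tdᵀ * Bl - q.G * C * Bl := by
    rw [Bbar, ← Matrix.mul_assoc, Matrix.mul_sub, ← Matrix.mul_assoc, hG, Matrix.mul_one,
      Matrix.sub_mul]
  have h3' := congrArg (fun M => M *ₑ x) h3
  simp only [add_mulE, sub_mulE, Matrix.sub_mul, zero_mulE] at h3'
  simp only [estimate, map_add, map_sub, mulE_mulE, ← Matrix.mul_assoc, hE, hG, hF, hB,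
    hTu.orthogonal, zero_mulE, sub_mulE, h2]
  -- The unknown input has cancelled through `G C B₋ = Tdᵀ B₋`; what remains is the third identity
  -- of `Omega` applied to `x`.
  refine sub_eq_zero.1 (Eq.trans ?_ h3')
  abel

/-- The derivative of the undetectable part of the estimation error. -/
theorem undetectable_error_deriv (hTu : IsComplementBasis q.Td Tu)
    (x z : Vec n) (ul : Vec ml) (um : Vec r) (w : Vec (n - δ)) :
    Tuᵀ *ₑ ((Ebar A q Tu *ₑ z + Fbar A q Tu *ₑ (C *ₑ x) + Bbar C Bl q *ₑ ul - Tu *ₑ w)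
        + Gbar q *ₑ (C *ₑ (A *ₑ x + (Bl *ₑ ul + Bm *ₑ um)))
        - (A *ₑ x + (Bl *ₑ ul + Bm *ₑ um))) =
      Tuᵀ *ₑ A *ₑ (estimate C q z x - x) - Tuᵀ *ₑ Bm *ₑ um - w := by
  have h1 := hTu.transpose_mul_Td
  have hE : Tuᵀ * Ebar A q Tu = Tuᵀ * A := by
    simp only [Ebar, Matrix.mul_add, ← Matrix.mul_assoc, h1, hTu.orthonormal, Matrix.one_mul,
      Matrix.zero_mul, zero_add]
  have hG : Tuᵀ * Gbar q = 0 := by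
    simp only [Gbar, ← Matrix.mul_assoc, h1, Matrix.zero_mul]
  have hF : Tuᵀ * Fbar A q Tu = Tuᵀ * A * Gbar q := by
    simp only [Fbar, Matrix.mul_add, ← Matrix.mul_assoc, h1, hTu.orthonormal, Matrix.one_mul,
      Matrix.zero_mul, zero_add]
  have hB : Tuᵀ * Bbar C Bl q = Tuᵀ * Bl := by
    rw [Bbar, ← Matrix.mul_assoc, Matrix.mul_sub, ← Matrix.mul_assoc, hG, Matrix.mul_one,
      Matrix.zero_mul, sub_zero]
  simp only [estimate, map_add, map_sub, mulE_mulE, ← Matrix.mul_assoc, hE, hG, hF, hB,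
    hTu.orthonormal, zero_mulE, one_mulE, Matrix.zero_mul]
  abel

end ErrorDynamics


/-! ### Convergence of the distributed observer -/

section Observer

variable {n N : ℕ}

theorem exists_bound_linearMap {X Y : Type*} [NormedAddCommGroup X] [NormedSpace ℝ X]
    [FiniteDimensional ℝ X] [NormedAddCommGroup Y] [NormedSpace ℝ Y] (L : X →ₗ[ℝ] Y) :
    ∃ K, 0 ≤ K ∧ ∀ x, ‖L x‖ ≤ K * ‖x‖ :=
  ⟨‖LinearMap.toContinuousLinearMap L‖, norm_nonneg _,
    (LinearMap.toContinuousLinearMap L).le_opNorm⟩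

theorem tendsto_linearMap {X Y : Type*} [NormedAddCommGroup X] [NormedSpace ℝ X]
    [FiniteDimensional ℝ X] [NormedAddCommGroup Y] [NormedSpace ℝ Y] (L : X →ₗ[ℝ] Y)
    {f : ℝ → X} (hf : Tendsto f atTop (𝓝 0)) : Tendsto (fun t => L (f t)) atTop (𝓝 0) := by
  have := (L.continuous_of_finiteDimensional.tendsto 0).comp hf
  rwa [map_zero] at this

/-- Nodewise application of matrices `M i` to vectors. -/
noncomputable def blockMap {a : ℕ} {b : Fin N → ℕ} (M : ∀ i, Matrix (Fin (b i)) (Fin a) ℝ) :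
    (Fin N → Vec a) →ₗ[ℝ] (∀ i, Vec (b i)) :=
  LinearMap.pi fun i => Matrix.toEuclideanLin (M i) ∘ₗ LinearMap.proj i

/-- Only differences of estimates matter, so the measurable consensus error is also a function of
the unknown estimation errors. -/
theorem consensusError_sub_const {k : ℕ} (𝒢 : WeightedGraph N) (Tu : Matrix (Fin n) (Fin k) ℝ)
    (X : Fin N → Vec n) (x : Vec n) (i : Fin N) :
    consensusError 𝒢 Tu (fun j => X j - x) i = consensusError 𝒢 Tu X i := by
  simp only [consensusError, sub_sub_sub_cancel_right]

theorem unitDirSet_inner {k : ℕ} {ω s : Vec k} (hs : s ∈ unitDirSet ω) :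
    inner ℝ ω s = ‖ω‖ := by
  by_cases h : ω = 0
  · simp [h]
  · rw [hs.1 h, unitDir, real_inner_smul_right, real_inner_self_eq_norm_sq]
    have := norm_ne_zero_iff.2 h
    field_simp

open Matrix in
/-- The detectable part of the estimation error tends to zero. -/
theorem tendsto_detectable_error {p r δ : ℕ} {A : Matrix (Fin n) (Fin n) ℝ}
    {Bm : Matrix (Fin n) (Fin r) ℝ} {C : Matrix (Fin p) (Fin n) ℝ} {q : Quadruple n p δ}
    (hq : IsStrongDetectabilityDecomposition A Bm C q) {e : ℝ → Vec n} {x₀ : Vec n}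
    (h0 : e 0 = estimate C q 0 x₀ - x₀)
    (he : HasACDeriv (fun t => q.Tdᵀ *ₑ e t) fun t => q.E *ₑ q.Tdᵀ *ₑ e t) :
    Tendsto (fun t => q.Tdᵀ *ₑ e t) atTop (𝓝 0) := by
  by_cases hE : q.E = 0
  · have hG := (hq.static hE).1
    have h1 : q.Tdᵀ *ₑ e 0 = 0 := by
      simp only [h0, estimate, zero_add, map_sub, Gbar, mulE_mulE, ← Matrix.mul_assoc, hq.mem.1,
        Matrix.one_mul, hG, sub_self]
    simp only [hE, zero_mulE] at he
    refine tendsto_const_nhds.congr' ?_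
    filter_upwards [eventually_ge_atTop 0] with t ht
    rw [he.eq_of_deriv_zero ht, h1]
  · rcases hq.mem.2.2.2 with h | h
    · exact h.tendsto_zero he
    · exact absurd h.2 hE

end Observer

end DistObs

open DistObs in
theorem theorem1 {n m mv N : ℕ} {p ml mu δ : Fin N → ℕ}
    (A : Matrix (Fin n) (Fin n) ℝ) (B : Matrix (Fin n) (Fin m) ℝ)
    (Bv : Matrix (Fin n) (Fin mv) ℝ)
    (C : ∀ i, Matrix (Fin (p i)) (Fin n) ℝ)
    (Bl : ∀ i, Matrix (Fin n) (Fin (ml i)) ℝ)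
    (Bm : ∀ i, Matrix (Fin n) (Fin (mu i)) ℝ)
    (hC : ∀ i, LinearIndependent ℝ (C i).row)
    (hBm : ∀ i, LinearIndependent ℝ (Bm i).col)
    -- the observer graph
    (𝒢 : DistObs.WeightedGraph N) (h𝒢 : 𝒢.Connected)
    -- the decompositions and collective strong detectability
    (q : ∀ i, DistObs.Quadruple n (p i) (δ i))
    (hq : ∀ i, DistObs.IsStrongDetectabilityDecomposition A (Bm i) (C i) (q i))
    (hdet : DistObs.CollectivelyStronglyDetectable fun i => (q i).Td)
    (Tu : ∀ i, Matrix (Fin n) (Fin (n - δ i)) ℝ)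
    (hTu : ∀ i, DistObs.IsComplementBasis (q i).Td (Tu i))
    -- the step sizes of the adaptive laws
    (φ φs : Fin N → ℝ) (hφ : ∀ i, 0 < φ i) (hφs : ∀ i, 0 < φs i)
    -- the inputs, as seen globally and by each node
    (u : ℝ → DistObs.Vec m) (v : ℝ → DistObs.Vec mv)
    (ul : ∀ i, ℝ → DistObs.Vec (ml i)) (um : ∀ i, ℝ → DistObs.Vec (mu i))
    (hsplit : ∀ i, ∀ t : ℝ, 0 ≤ t →
      DistObs.mulE B (u t) + DistObs.mulE Bv (v t) =
        DistObs.mulE (Bl i) (ul i t) + DistObs.mulE (Bm i) (um i t))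
    (hv : ∃ vbar : ℝ, ∀ t : ℝ, 0 ≤ t → ‖v t‖ ≤ vbar)
    (hum : ∀ i, ∃ ubar : ℝ, ∀ t : ℝ, 0 ≤ t → ‖um i t‖ ≤ ubar)
    -- the trajectories of the plant and of the observer
    (x : ℝ → DistObs.Vec n) (hx : DistObs.IsPlantTrajectory A B Bv u v x)
    (z : Fin N → ℝ → DistObs.Vec n) (γ γs : Fin N → ℝ → ℝ)
    (hobs : DistObs.IsObserverTrajectory A C Bl 𝒢 q Tu φ φs x ul z γ γs) :
    (∀ i, Tendsto (fun t => ‖DistObs.estimate (C i) (q i) (z i t) (x t) - x t‖) atTop (𝓝 0)) ∧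
    (∀ i, ∃ M : ℝ, ∀ t : ℝ, 0 ≤ t → |γ i t| ≤ M ∧ |γs i t| ≤ M) := by
  -- the estimation errors
  set x' : ℝ → Vec n := fun t => A *ₑ x t + B *ₑ u t + Bv *ₑ v t with hx'
  have hxd : HasACDeriv x x' := ⟨hx.ac, hx.deriv⟩
  -- The observer is a differential inclusion with a selection depending on `t`; using `deriv`
  -- avoids choosing one.
  have hzd : ∀ i, HasACDeriv (z i) (deriv (z i)) := fun i => by
    refine ⟨hobs.ac_z i, ?_⟩
    filter_upwards [hobs.deriv_z i] with t h ht
    obtain ⟨s, -, hs⟩ := h ht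
    rwa [hs.deriv]
  let e : ℝ → Fin N → Vec n := fun t i => estimate (C i) (q i) (z i t) (x t) - x t
  let e' : ℝ → Fin N → Vec n := fun t i =>
    deriv (z i) t + Gbar (q i) *ₑ (C i *ₑ x' t) - x' t
  have hei : ∀ i, HasACDeriv (fun t => e t i) fun t => e' t i := fun i =>
    ((hzd i).add ((hxd.linearMap (Matrix.toEuclideanLin (C i))).linearMap
      (Matrix.toEuclideanLin (Gbar (q i))))).sub hxd
  have he : HasACDeriv e e' := .pi hei
  have hcons : ∀ t i, consensusError 𝒢 (Tu i)
      (fun j => estimate (C j) (q j) (z j t) (x t)) i = consensusMap 𝒢 Tu (e t) i := fun t i =>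
    (consensusError_sub_const 𝒢 (Tu i) _ (x t) i).symm
  have hx'' : ∀ i t, 0 < t → x' t = A *ₑ x t + (Bl i *ₑ ul i t + Bm i *ₑ um i t) :=
    fun i t ht => by rw [← hsplit i t ht.le, ← add_assoc]
  have hdz : ∀ i, ∀ᵐ t : ℝ, 0 < t → ∃ s : Vec (n - δ i), ‖s‖ ≤ 1 ∧
      inner ℝ (consensusMap 𝒢 Tu (e t) i) s = ‖consensusMap 𝒢 Tu (e t) i‖ ∧
      deriv (z i) t = Ebar A (q i) (Tu i) *ₑ z i t + Fbar A (q i) (Tu i) *ₑ (C i *ₑ x t)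
          + Bbar (C i) (Bl i) (q i) *ₑ ul i t
          - Tu i *ₑ (γ i t • consensusMap 𝒢 Tu (e t) i + γs i t • s) := by
    intro i
    filter_upwards [hobs.deriv_z i] with t h ht
    obtain ⟨s, hs, hs'⟩ := h ht
    rw [hcons] at hs hs'
    exact ⟨s, hs.2, unitDirSet_inner hs, by simp only [hs'.deriv, map_add, map_smul]⟩
  -- the detectable parts
  let Ed : (Fin N → Vec n) →ₗ[ℝ] (Fin N → Vec n) :=
    blockMap fun i => (q i).Td * (q i).E * (q i).Td.transpose
  let Pd : (Fin N → Vec n) →ₗ[ℝ] (Fin N → Vec n) := blockMap fun i => (q i).Td * (q i).Td.transpose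
  have hdet_i : ∀ i, HasACDeriv (fun t => (q i).Td.transpose *ₑ e t i)
      fun t => (q i).E *ₑ (q i).Td.transpose *ₑ e t i := by
    intro i
    refine ((hei i).linearMap (Matrix.toEuclideanLin (q i).Td.transpose)).congr_deriv ?_
    filter_upwards [hdz i] with t h ht
    obtain ⟨s, -, -, hs⟩ := h ht
    simp only [e', hs, hx'' i t ht]
    exact detectable_error_deriv (hq i).mem (hTu i) _ _ _ _ _
  -- A closed linear equation for the detectable parts lets the derivative of the shift in `ζ` be
  -- written as a linear function of `Pd (e t)`, hence bounded.
  have hD : HasACDeriv (fun t => Pd (e t)) fun t => Ed (Pd (e t)) := by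
    refine .pi fun i => ?_
    have hPd : (fun t => Pd (e t) i) = fun t => (q i).Td *ₑ (q i).Td.transpose *ₑ e t i :=
      funext fun t => (mulE_mulE _ _ _).symm
    rw [hPd]
    refine ((hdet_i i).linearMap (Matrix.toEuclideanLin (q i).Td)).congr_deriv
      (Eventually.of_forall fun t _ => ?_)
    change (q i).Td *ₑ (q i).E *ₑ (q i).Td.transpose *ₑ e t i =
      ((q i).Td * (q i).E * (q i).Td.transpose) *ₑ ((q i).Td * (q i).Td.transpose) *ₑ e t i
    rw [mulE_mulE, mulE_mulE, mulE_mulE, Matrix.mul_assoc _ (q i).Td.transpose,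
      ← Matrix.mul_assoc (q i).Td.transpose, (hq i).mem.1, Matrix.one_mul]
  have hD0 : Tendsto (fun t => Pd (e t)) atTop (𝓝 0) := by
    refine tendsto_pi_nhds.2 fun i => ?_
    have h := tendsto_linearMap (Matrix.toEuclideanLin (q i).Td)
      (tendsto_detectable_error (hq i) (x₀ := x 0) (by simp only [e, hobs.init_z i]) (hdet_i i))
    refine h.congr fun t => ?_
    exact mulE_mulE _ _ _
  -- the projected Laplacian and the shifted undetectable parts
  let P := projectedLaplacian 𝒢 Tu
  have hinj : Function.Injective P := projectedLaplacian_injective h𝒢 hdet hTu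
  let Q := (LinearEquiv.ofInjectiveEndo P hinj).symm.toLinearMap
  have hPQ : ∀ y, P (Q y) = y := (LinearEquiv.ofInjectiveEndo P hinj).apply_symm_apply
  have hQP : ∀ y, Q (P y) = y := (LinearEquiv.ofInjectiveEndo P hinj).symm_apply_apply
  let R := Q ∘ₗ consensusMap 𝒢 Tu
  let U : (Fin N → Vec n) →ₗ[ℝ] PiLp 2 fun i => Vec (n - δ i) :=
    (WithLp.linearEquiv 2 ℝ (∀ i, Vec (n - δ i))).symm.toLinearMap ∘ₗ
      blockMap fun i => (Tu i).transpose
  let 𝒜 : (Fin N → Vec n) →ₗ[ℝ] (Fin N → Vec n) := blockMap fun _ => A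
  have hsplit_e : ∀ X : Fin N → Vec n, Pd X + liftMap Tu (U X) = X := fun X => by
    ext1 i
    have := (hTu i).decomp (X i)
    rw [mulE_mulE] at this
    exact this
  -- `P ∘ R` is `consensusMap`, so the shift absorbs the detectable contribution to the consensus
  -- error exactly.
  let ζ : ℝ → PiLp 2 fun i => Vec (n - δ i) := fun t => U (e t) + R (Pd (e t))
  have hζ : HasACDeriv ζ fun t => U (e' t) + R (Ed (Pd (e t))) :=
    (he.linearMap U).add (hD.linearMap R)
  have hPζ : ∀ t, P (ζ t) = consensusMap 𝒢 Tu (e t) := by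
    intro t
    have h1 : P (ζ t) = consensusMap 𝒢 Tu (liftMap Tu (U (e t))) +
        consensusMap 𝒢 Tu (Pd (e t)) := by
      simp only [ζ, map_add, R, LinearMap.comp_apply, hPQ]
      rfl
    rw [h1, ← map_add, add_comm, hsplit_e]
  let b : ℝ → PiLp 2 fun i => Vec (n - δ i) := fun t =>
    WithLp.toLp 2 fun i => (Tu i).transpose *ₑ Bm i *ₑ um i t
  let f : ℝ → PiLp 2 fun i => Vec (n - δ i) := fun t =>
    U (𝒜 (e t)) - b t + R (Ed (Pd (e t)))
  have hζ' : ∀ᵐ t : ℝ, 0 < t → ∀ i, ∃ s : Vec (n - δ i), ‖s‖ ≤ 1 ∧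
      inner ℝ (P (ζ t) i) s = ‖P (ζ t) i‖ ∧
      (U (e' t) + R (Ed (Pd (e t)))) i = f t i - (γ i t • P (ζ t) i + γs i t • s) := by
    filter_upwards [ae_all_iff.2 hdz] with t h ht i
    obtain ⟨s, hs1, hs2, hs3⟩ := h i ht
    rw [hPζ]
    refine ⟨s, hs1, hs2, ?_⟩
    have h1 : U (e' t) i = (Tu i).transpose *ₑ A *ₑ e t i - (Tu i).transpose *ₑ Bm i *ₑ um i t
        - (γ i t • consensusMap 𝒢 Tu (e t) i + γs i t • s) := by
      change (Tu i).transpose *ₑ e' t i = _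
      simp only [e', hs3, hx'' i t ht]
      exact undetectable_error_deriv (hTu i) _ _ _ _ _
    change U (e' t) i + R (Ed (Pd (e t))) i = (Tu i).transpose *ₑ A *ₑ e t i -
      (Tu i).transpose *ₑ Bm i *ₑ um i t + R (Ed (Pd (e t))) i - _
    rw [h1]
    abel
  -- the growth bound for the drift
  obtain ⟨K₁, -, hK₁⟩ := exists_bound_linearMap (U ∘ₗ 𝒜 ∘ₗ liftMap Tu ∘ₗ Q)
  obtain ⟨K₂, hK₂0, hK₂⟩ : ∃ K, 0 ≤ K ∧ ∀ t, 0 ≤ t →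
      ‖U (𝒜 (Pd (e t) - liftMap Tu (R (Pd (e t))))) + R (Ed (Pd (e t)))‖ + ‖b t‖ ≤ K := by
    obtain ⟨K, hK0, hK⟩ := exists_bound_linearMap
      (U ∘ₗ 𝒜 ∘ₗ (LinearMap.id - liftMap Tu ∘ₗ R) + R ∘ₗ Ed)
    obtain ⟨M, hM⟩ := hD.ac.bounded_of_tendsto hD0
    choose ubar hubar using hum
    choose L hL0 hL using fun i => exists_bound_linearMap
      (Matrix.toEuclideanLin (Tu i).transpose ∘ₗ Matrix.toEuclideanLin (Bm i))
    have hM0 := (norm_nonneg _).trans (hM 0 le_rfl)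
    have hu0 := fun i => (norm_nonneg _).trans (hubar i 0 le_rfl)
    refine ⟨K * M + ∑ i, L i * ubar i, add_nonneg (mul_nonneg hK0 hM0)
      (Finset.sum_nonneg fun i _ => mul_nonneg (hL0 i) (hu0 i)), fun t ht => add_le_add ?_ ?_⟩
    · exact (hK (Pd (e t))).trans (mul_le_mul_of_nonneg_left (hM t ht) hK0)
    · exact (norm_le_sum_norm _).trans (Finset.sum_le_sum fun i _ =>
        (hL i (um i t)).trans (mul_le_mul_of_nonneg_left (hubar i t ht) (hL0 i)))
  have hU : ∀ t, U (e t) = Q (P (ζ t)) - R (Pd (e t)) := fun t => by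
    rw [hQP, add_sub_cancel_right]
  have hf : ∀ t, 0 ≤ t → ‖f t‖ ≤ K₁ * ‖P (ζ t)‖ + K₂ := by
    intro t ht
    have h1 : f t = U (𝒜 (liftMap Tu (Q (P (ζ t))))) +
        ((U (𝒜 (Pd (e t) - liftMap Tu (R (Pd (e t))))) + R (Ed (Pd (e t)))) - b t) := by
      have h2 : U (𝒜 (e t)) = U (𝒜 (Pd (e t) + liftMap Tu (U (e t)))) := by rw [hsplit_e]
      simp only [f]
      rw [h2, hU]
      simp only [map_add, map_sub]
      abel
    rw [h1]
    exact (norm_add_le _ _).trans (add_le_add (hK₁ _) ((norm_sub_le _ _).trans (hK₂ t ht)))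
  have hγ : ∀ i, HasACDeriv (γ i) fun t => φ i * ‖P (ζ t) i‖ ^ 2 := fun i =>
    ⟨hobs.ac_γ i, by simpa only [hPζ, hcons] using hobs.deriv_γ i⟩
  have hγs : ∀ i, HasACDeriv (γs i) fun t => φs i * ‖P (ζ t) i‖ := fun i =>
    ⟨hobs.ac_γs i, by simpa only [hPζ, hcons] using hobs.deriv_γs i⟩
  obtain ⟨hlim, hgain⟩ := adaptive_convergence P (projectedLaplacian_isSymmetric 𝒢 Tu)
    (projectedLaplacian_nonneg 𝒢 Tu) hφ hφs hK₂0 hζ hζ' hf hγ hγs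
  refine ⟨fun i => ?_, hgain⟩
  have hUlim : Tendsto (fun t => U (e t)) atTop (𝓝 0) := by
    simp only [hU]
    simpa using (tendsto_linearMap Q hlim).sub (tendsto_linearMap R hD0)
  have helim : Tendsto e atTop (𝓝 0) := by
    have := hD0.add (tendsto_linearMap (liftMap Tu) hUlim)
    simpa only [hsplit_e, add_zero] using this
  exact tendsto_zero_iff_norm_tendsto_zero.1 (tendsto_pi_nhds.1 helim i)
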